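/- Let $G=(V,E)$ be a finite simple undirected graph, regarded as an electrical network in which every edge is a unit resistor, and let $r^G_{ij}$ be the effective resistance between adjacent nodes $i$ and $j$, i.e. the potential difference between $i$ and $j$ when a unit current flows from $i$ to $j$. For a labeling $y\in\{-1,+1\}^V$ let $$\Phi^R_G(y)=\sum_{\{i,j\}\in E,\ y_i\neq y_j} r^G_{ij}.$$ A randomized active learner $A$ queries nodes one after the other, where the choice of the next node and the decision to stop may depend on the labels received so far and on internal randomness. When it stops, it outputs predicted labels, which may depend on all of this as well. Let $L$ be the set of queried nodes. The mistakes of $A$ are the nodes of $V\setminus L$ whose predicted label is wrong. Theorem. There is an absolute constant $K_0$ such that for every finite simple graph $G=(V,E)$ and every real number $K$ with $0\le K\le |V|/2$ there is a probability distribution of labelings $y\in\{-1,+1\}^V$, independent of the learner, such that (1) every randomized active learner $A$ that on every labeling always queries a set of size $|L|\le |V|/4$ makes, on a random labeling $y$ drawn from this distribution independently of the internal randomness of $A$, an expected number of mistakes on $V\setminus L$ of at least $K/4$; (2) $\mathbb E\,[\Phi^R_G(y)]\le K$; and (3) if $K\ge K_0$, then $\Phi^R_G(y)\le K$ holds with probability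 one. -/

import Mathlib

open scoped ENNReal Matrix

universe u

namespace ActiveGraph

/-! ### Effective resistance and the resistance-weighted cutsize

`G.lapMatrix ℝ` is the Laplacian of the electrical network in which every edge of `G` is a unit
resistor: a vector of node potentials `x` induces the net currents `G.lapMatrix ℝ *ᵥ x`. -/

section Resistance

variable {V : Type u} [Fintype V] [DecidableEq V]

/-- `x` is a vector of node potentials under which one unit of current enters the network `G`
at `i` and leaves it at `j`. -/
def IsUnitPotential (G : SimpleGraph V) [DecidableRel G.Adj] (i j : V) (x : V → ℝ) : Prop :=
  G.lapMatrix ℝ *ᵥ x = Pi.single i 1 - Pi.single j 1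

open Classical in
/-- The effective resistance between `i` and `j`: the potential difference `x i - x j` when a unit
current flows from `i` to `j`. It does not depend on the choice of the potentials
(`effectiveResistance_eq`), and potentials exist whenever `i` and `j` are joined by a walk
(`exists_isUnitPotential`), in particular whenever they are adjacent. For nodes in different
connected components the value is the placeholder `0`, which is never used below. -/
noncomputable def effectiveResistance (G : SimpleGraph V) [DecidableRel G.Adj] (i j : V) : ℝ :=
  if h : ∃ x : V → ℝ, IsUnitPotential G i j x then h.choose i - h.choose j else 0

theorem IsUnitPotential.sub_eq {G : SimpleGraph V} [DecidableRel G.Adj] {i j : V} {x z : V → ℝ}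
    (hx : IsUnitPotential G i j x) (hz : IsUnitPotential G i j z) : x i - x j = z i - z j := by
  have h : x ⬝ᵥ (G.lapMatrix ℝ *ᵥ z) = z ⬝ᵥ (G.lapMatrix ℝ *ᵥ x) := by
    rw [Matrix.dotProduct_mulVec, ← Matrix.mulVec_transpose, (G.isSymm_lapMatrix (R := ℝ)).eq,
      dotProduct_comm]
  unfold IsUnitPotential at hx hz
  rw [hx, hz] at h
  simpa [dotProduct_sub] using h

theorem effectiveResistance_eq {G : SimpleGraph V} [DecidableRel G.Adj] {i j : V} {x : V → ℝ}
    (hx : IsUnitPotential G i j x) : effectiveResistance G i j = x i - x j := by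
  have h : ∃ x : V → ℝ, IsUnitPotential G i j x := ⟨x, hx⟩
  rw [effectiveResistance, dif_pos h]
  exact h.choose_spec.sub_eq hx

theorem exists_isUnitPotential {G : SimpleGraph V} [DecidableRel G.Adj] {i j : V}
    (h : G.Reachable i j) : ∃ x : V → ℝ, IsUnitPotential G i j x := by
  let T := Matrix.toEuclideanLin (G.lapMatrix ℝ)
  have hT : T.IsSymmetric :=
    Matrix.isSymmetric_toEuclideanLin_iff.mpr (G.isHermitian_lapMatrix (R := ℝ))
  let b : EuclideanSpace ℝ V := WithLp.toLp 2 (Pi.single i 1 - Pi.single j 1)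
  have hb : b ∈ LinearMap.range T := by
    rw [← Submodule.orthogonal_orthogonal (LinearMap.range T), hT.orthogonal_range]
    rw [Submodule.mem_orthogonal]
    intro z hz
    have hz' : G.lapMatrix ℝ *ᵥ z.ofLp = 0 := by
      have := congrArg WithLp.ofLp (LinearMap.mem_ker.mp hz)
      simpa [T, Matrix.toEuclideanLin] using this
    have hij := (SimpleGraph.lapMatrix_mulVec_eq_zero_iff_forall_reachable G).mp hz' i j h
    simp [b, inner_sub_right, PiLp.inner_apply, hij]
  obtain ⟨x, hx⟩ := hb
  refine ⟨x.ofLp, ?_⟩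
  have := congrArg WithLp.ofLp hx
  simpa [T, b, Matrix.toEuclideanLin, IsUnitPotential] using this

/-- `Φ^R_G(y)`: the sum of the effective resistances over the edges of `G` whose endpoints carry
different labels. Each such edge occurs as two ordered pairs, hence the factor `1 / 2`. -/
noncomputable def resistanceCutsize (G : SimpleGraph V) [DecidableRel G.Adj] (y : V → ℤˣ) : ℝ :=
  (1 / 2) * ∑ i, ∑ j, if G.Adj i j ∧ y i ≠ y j then effectiveResistance G i j else 0

end Resistance

/-! ### Active learners

Labels are elements of `ℤˣ = {-1, +1}`. -/

/-- A deterministic adaptive active learner on the node set `V`: it either stops and outputs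
predicted labels, or queries a node and continues depending on the label it receives. -/
inductive Learner (V : Type u) : Type u
  | predict (p : V → ℤˣ) : Learner V
  | query (v : V) (next : ℤˣ → Learner V) : Learner V

namespace Learner

variable {V : Type u} [DecidableEq V]

/-- The query set `L`: the set of all nodes queried in the run on the labeling `y`. -/
def querySet : Learner V → (V → ℤˣ) → Finset V
  | predict _, _ => ∅
  | query v next, y => insert v ((next (y v)).querySet y)

/-- The prediction output at the end of the run on the labeling `y`. -/
def prediction : Learner V → (V → ℤˣ) → V → ℤˣ
  | predict p, _ => p
  | query v next, y => (next (y v)).prediction y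

/-- The number of prediction mistakes on the nodes outside the query set. -/
def mistakes [Fintype V] (A : Learner V) (y : V → ℤˣ) : ℕ :=
  (Finset.univ.filter fun v => v ∉ A.querySet y ∧ A.prediction y v ≠ y v).card

end Learner

section Randomized

variable {V : Type u} [Fintype V] [DecidableEq V]

/-- A randomized adaptive learner is a probability distribution `ρ` over deterministic ones (for a
finite node set there are only countably many of these). It makes at most `|V| / 4` queries if each
of its realizations does so, on every labeling. -/
def QueriesAtMostQuarter (ρ : PMF (Learner V)) : Prop :=
  ∀ A ∈ ρ.support, ∀ y : V → ℤˣ, ((A.querySet y).card : ℝ) ≤ (Fintype.card V : ℝ) / 4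

/-- The expected number of mistakes of the randomized learner `ρ` on a random labeling with law
`μ`, the internal randomness of the learner being independent of the labeling. -/
noncomputable def expectedMistakes (μ : PMF (V → ℤˣ)) (ρ : PMF (Learner V)) : ℝ≥0∞ :=
  ∑' y, ∑' A, μ y * ρ A * (A.mistakes y : ℝ≥0∞)

/-- The expected resistance-weighted cutsize of a random labeling with law `μ`. -/
noncomputable def expectedCutsize (G : SimpleGraph V) [DecidableRel G.Adj]
    (μ : PMF (V → ℤˣ)) : ℝ :=
  ∑ y, (μ y).toReal * resistanceCutsize G y

end Randomized

end ActiveGraph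

/-! Charge each cut edge to its endpoint labelled `-1`: the cutsize is at most the total
`resistanceDegree` of the negative nodes. By Foster's theorem these degrees sum to at most `2|V|`,
so independent labels, negative with probability `c` where `c|V| = 9K/20`, have expected cutsize at
most `9K/10`.

A run never sees the label of an unqueried node, and `-1` is the less likely label, so any
prediction there errs with probability at least that of `-1` (`sum_mul_card_le_sum_mul_mistakes`).
This forces a number of mistakes linear in `K`.

For the almost sure bound, labelings whose negative weight exceeds `K` are replaced by the constant
labeling `1`. The mistake argument survives on the remaining mass, because turning a `-1` into `1`
only lowers the weight. What is lost is the mean number of negative nodes on the excluded event.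
Allowing negative labels only at nodes of degree at most `16` makes the variance of the weight
`O(K)`, so Chebyshev's inequality bounds this loss by a constant (`sum_labelWeight_mul_tail_le`),
which the slack in the linear bound absorbs for large `K`. -/

namespace ActiveGraph

/-! ### Effective resistances and Foster's theorem -/

section Foster

variable {V : Type u} [Fintype V] [DecidableEq V]

/-- A real symmetric matrix has a generalized inverse `P` with `tr (P M)` at most its size. -/
theorem exists_generalizedInverse {M : Matrix V V ℝ} (hM : M.IsHermitian) :
    ∃ P : Matrix V V ℝ, M * P * M = M ∧ (P * M).trace ≤ Fintype.card V := by
  set U : Matrix V V ℝ := (hM.eigenvectorUnitary : Matrix V V ℝ) with hU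
  have hUU : star U * U = 1 := Unitary.coe_star_mul_self _
  set D : Matrix V V ℝ := Matrix.diagonal hM.eigenvalues with hD
  -- Since `0⁻¹ = 0`, this inverts only the nonzero eigenvalues; the trace below counts them.
  set E : Matrix V V ℝ := Matrix.diagonal fun i => (hM.eigenvalues i)⁻¹ with hE
  have hspec : M = U * D * star U := by
    have := hM.spectral_theorem
    simpa [Unitary.conjStarAlgAut_apply, Function.comp_def] using this
  have hDED : D * E * D = D := by
    simp only [hD, hE, Matrix.diagonal_mul_diagonal, mul_inv_mul_cancel]
  refine ⟨U * E * star U, ?_, ?_⟩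
  · calc M * (U * E * star U) * M
        = U * D * (star U * U) * E * (star U * U) * D * star U := by
          rw [hspec]; simp only [Matrix.mul_assoc]
      _ = U * (D * E * D) * star U := by
          rw [hUU]; simp only [Matrix.mul_assoc, Matrix.one_mul]
      _ = M := by rw [hDED, ← hspec]
  · have h : (U * E * star U * M).trace = (E * D).trace := by
      calc (U * E * star U * M).trace = (U * (E * (star U * U) * D * star U)).trace := by
            conv_lhs => rw [hspec]
            simp only [Matrix.mul_assoc]
        _ = (E * D * (star U * U)).trace := by
            rw [Matrix.trace_mul_comm, hUU]; simp only [Matrix.mul_assoc, Matrix.one_mul, hUU]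
        _ = (E * D).trace := by rw [hUU, Matrix.mul_one]
    rw [h, hD, hE, Matrix.diagonal_mul_diagonal, Matrix.trace_diagonal]
    calc ∑ i, (hM.eigenvalues i)⁻¹ * hM.eigenvalues i ≤ ∑ _i : V, (1 : ℝ) :=
          Finset.sum_le_sum fun i _ => inv_mul_le_one
      _ = Fintype.card V := by simp

theorem effectiveResistance_nonneg (G : SimpleGraph V) [DecidableRel G.Adj] (i j : V) :
    0 ≤ effectiveResistance G i j := by
  by_cases h : ∃ x : V → ℝ, IsUnitPotential G i j x
  · obtain ⟨x, hx⟩ := h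
    rw [effectiveResistance_eq hx]
    have hpos := (SimpleGraph.posSemidef_lapMatrix ℝ G).dotProduct_mulVec_nonneg x
    unfold IsUnitPotential at hx
    rw [hx] at hpos
    simpa [dotProduct_sub] using hpos
  · rw [effectiveResistance, dif_neg h]

/-- With `L x = b`, the identity `L P L = L` gives `L P b = b`, so `x ⬝ b = (L x) ⬝ P b = b ⬝ P b`.
Symmetry of `P` is not needed, hence the two cross terms. -/
theorem effectiveResistance_eq_quadraticForm {G : SimpleGraph V} [DecidableRel G.Adj]
    {P : Matrix V V ℝ} (hP : G.lapMatrix ℝ * P * G.lapMatrix ℝ = G.lapMatrix ℝ) {i j : V}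
    (h : G.Reachable i j) :
    effectiveResistance G i j = P i i - P i j - P j i + P j j := by
  obtain ⟨x, hx⟩ := exists_isUnitPotential h
  rw [effectiveResistance_eq hx]
  unfold IsUnitPotential at hx
  set b : V → ℝ := Pi.single i 1 - Pi.single j 1 with hb
  have h1 : x i - x j = x ⬝ᵥ b := by simp [hb, dotProduct_sub]
  have h2 : x ⬝ᵥ b = b ⬝ᵥ (P *ᵥ b) := by
    have h3 : b = G.lapMatrix ℝ *ᵥ (P *ᵥ b) := by
      conv_lhs => rw [← hx, ← hP]
      rw [← Matrix.mulVec_mulVec, ← Matrix.mulVec_mulVec, hx]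
    conv_lhs => rw [h3]
    rw [Matrix.dotProduct_mulVec, ← Matrix.mulVec_transpose, (G.isSymm_lapMatrix (R := ℝ)).eq, hx]
  rw [h1, h2]
  simp [hb, Matrix.mulVec_sub, sub_dotProduct, dotProduct_sub]
  ring

/-- Foster's theorem, as an inequality: the effective resistances of the edges sum up to at most
the number of nodes (each edge occurs twice in the sum below). -/
theorem sum_effectiveResistance_le (G : SimpleGraph V) [DecidableRel G.Adj] :
    ∑ i, ∑ j, (if G.Adj i j then effectiveResistance G i j else 0) ≤ 2 * Fintype.card V := by
  obtain ⟨P, hP, htr⟩ := exists_generalizedInverse (G.isHermitian_lapMatrix (R := ℝ))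
  have hterm : ∀ i j, (if G.Adj i j then effectiveResistance G i j else 0) =
      G.adjMatrix ℝ i j * P i i - G.adjMatrix ℝ i j * P i j - G.adjMatrix ℝ i j * P j i +
        G.adjMatrix ℝ i j * P j j := by
    intro i j
    by_cases h : G.Adj i j
    · simp [h, effectiveResistance_eq_quadraticForm hP h.reachable]
    · simp [h]
  have hdeg : ∀ i, ∑ j, G.adjMatrix ℝ i j = G.degree i := by
    intro i
    simp [SimpleGraph.adjMatrix_apply, ← G.card_neighborFinset_eq_degree,
      SimpleGraph.neighborFinset_eq_filter]
  have hsymm : ∀ i j, G.adjMatrix ℝ i j = G.adjMatrix ℝ j i := fun i j => by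
    simp [SimpleGraph.adjMatrix_apply, G.adj_comm]
  -- Over ordered adjacent pairs, the quadratic forms sum to twice this trace.
  have htrace : (P * G.lapMatrix ℝ).trace =
      ∑ i, G.degree i * P i i - ∑ i, ∑ j, G.adjMatrix ℝ i j * P i j := by
    rw [SimpleGraph.lapMatrix, Matrix.mul_sub, Matrix.trace_sub]
    congr 1
    · simp [Matrix.trace, SimpleGraph.degMatrix, Matrix.mul_diagonal, mul_comm]
    · simp only [Matrix.trace, Matrix.diag_apply, Matrix.mul_apply]
      exact Finset.sum_congr rfl fun i _ => Finset.sum_congr rfl fun j _ => by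
        rw [hsymm j i, mul_comm]
  have hswap : ∑ i, ∑ j, G.adjMatrix ℝ i j * P j i = ∑ i, ∑ j, G.adjMatrix ℝ i j * P i j := by
    rw [Finset.sum_comm]
    exact Finset.sum_congr rfl fun i _ => Finset.sum_congr rfl fun j _ => by rw [hsymm]
  have hdiag : ∑ i, ∑ j, G.adjMatrix ℝ i j * P i i = ∑ i, G.degree i * P i i :=
    Finset.sum_congr rfl fun i _ => by rw [← Finset.sum_mul, hdeg]
  have hdiag' : ∑ i, ∑ j, G.adjMatrix ℝ i j * P j j = ∑ i, G.degree i * P i i := by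
    rw [Finset.sum_comm, ← hdiag]
    exact Finset.sum_congr rfl fun i _ => Finset.sum_congr rfl fun j _ => by rw [hsymm]
  simp only [hterm, Finset.sum_add_distrib, Finset.sum_sub_distrib, hswap, hdiag, hdiag']
  linarith

/-- The sum of the effective resistances of the edges at `i`. -/
noncomputable def resistanceDegree (G : SimpleGraph V) [DecidableRel G.Adj] (i : V) : ℝ :=
  (1 / 2) * ∑ j, ((if G.Adj i j then effectiveResistance G i j else 0) +
    if G.Adj j i then effectiveResistance G j i else 0)

theorem resistanceDegree_nonneg (G : SimpleGraph V) [DecidableRel G.Adj] (i : V) :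
    0 ≤ resistanceDegree G i := by
  refine mul_nonneg (by norm_num) (Finset.sum_nonneg fun j _ => add_nonneg ?_ ?_) <;>
  · split_ifs
    · exact effectiveResistance_nonneg G _ _
    · exact le_rfl

theorem sum_resistanceDegree_le (G : SimpleGraph V) [DecidableRel G.Adj] :
    ∑ i, resistanceDegree G i ≤ 2 * Fintype.card V := by
  have h := sum_effectiveResistance_le G
  have hc : ∑ i, ∑ j, (if G.Adj j i then effectiveResistance G j i else 0) =
      ∑ i, ∑ j, (if G.Adj i j then effectiveResistance G i j else 0) := Finset.sum_comm
  simp only [resistanceDegree, ← Finset.mul_sum, Finset.sum_add_distrib, hc]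
  linarith

/-- The total weight of the nodes with the label `-1`. -/
def negWeight (w : V → ℝ) (y : V → ℤˣ) : ℝ := ∑ v, if y v = -1 then w v else 0

/-- A cut edge has exactly one endpoint labelled `-1`, which pays for it. -/
theorem resistanceCutsize_le_negWeight (G : SimpleGraph V) [DecidableRel G.Adj] (y : V → ℤˣ) :
    resistanceCutsize G y ≤ negWeight (resistanceDegree G) y := by
  let r : V → V → ℝ := fun i j => if G.Adj i j then effectiveResistance G i j else 0
  have hr : ∀ i j, 0 ≤ r i j := fun i j => by
    simp only [r]
    split_ifs
    · exact effectiveResistance_nonneg G _ _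
    · exact le_rfl
  have h1 : resistanceCutsize G y ≤
      (1 / 2) * ∑ i, ∑ j, ((if y i = -1 then r i j else 0) + if y j = -1 then r i j else 0) := by
    refine mul_le_mul_of_nonneg_left (Finset.sum_le_sum fun i _ => Finset.sum_le_sum fun j _ => ?_)
      (by norm_num)
    have := hr i j
    by_cases h : G.Adj i j ∧ y i ≠ y j
    · rw [if_pos h]
      have hrij : effectiveResistance G i j = r i j := by simp [r, h.1]
      rw [hrij]
      rcases Int.units_eq_one_or (y i) with hi | hi <;>
        rcases Int.units_eq_one_or (y j) with hj | hj
      · exact absurd (hi.trans hj.symm) h.2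
      · simp [hi, hj]
      · simp [hi, hj]
      · exact absurd (hi.trans hj.symm) h.2
    · rw [if_neg h]
      split_ifs <;> linarith
  refine h1.trans (le_of_eq ?_)
  simp only [negWeight, resistanceDegree, Finset.sum_add_distrib]
  rw [Finset.sum_comm (f := fun i j => if y j = -1 then r i j else 0), ← Finset.sum_add_distrib,
    Finset.mul_sum]
  refine Finset.sum_congr rfl fun i _ => ?_
  by_cases h : y i = -1 <;> simp [h, r]

end Foster

/-! ### What a run can depend on -/

section Learner

variable {V : Type u} [DecidableEq V]

/-- The run of a learner does not depend on the labels of nodes which it does not query. -/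
theorem Learner.run_update_of_notMem (A : Learner V) (y : V → ℤˣ) (v : V) (s : ℤˣ)
    (h : v ∉ A.querySet y) :
    A.querySet (Function.update y v s) = A.querySet y ∧
      A.prediction (Function.update y v s) = A.prediction y := by
  induction A with
  | predict p => exact ⟨rfl, rfl⟩
  | query w next ih =>
    simp only [querySet, Finset.mem_insert, not_or] at h
    have hw : Function.update y v s w = y w := Function.update_of_ne (Ne.symm h.1) _ _
    obtain ⟨h1, h2⟩ := ih (y w) h.2
    simp only [querySet, prediction, hw, h1, h2, and_self]

theorem Learner.mem_querySet_update_iff (A : Learner V) (y : V → ℤˣ) (v : V) (s : ℤˣ) :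
    v ∈ A.querySet (Function.update y v s) ↔ v ∈ A.querySet y := by
  by_cases h : v ∈ A.querySet y
  · refine iff_of_true ?_ h
    by_contra h'
    have := (A.run_update_of_notMem _ v (y v) h').1
    rw [Function.update_idem, Function.update_eq_self] at this
    exact h' (this ▸ h)
  · rw [(A.run_update_of_notMem y v s h).1]

end Learner

/-! ### Independent labels -/

section ProductWeight

variable {V : Type u} [Fintype V]

theorem negWeight_mono {w w' : V → ℝ} (h : ∀ v, w v ≤ w' v) (y : V → ℤˣ) :
    negWeight w y ≤ negWeight w' y :=
  Finset.sum_le_sum fun v _ => by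
    split_ifs
    · exact h v
    · exact le_rfl

/-- The probability of `y` if the labels are independent, that of `v` being `-1` with
probability `q v`. -/
def labelWeight (q : V → ℝ) (y : V → ℤˣ) : ℝ := ∏ v, if y v = -1 then q v else 1 - q v

theorem labelWeight_nonneg {q : V → ℝ} (h0 : ∀ v, 0 ≤ q v) (h1 : ∀ v, q v ≤ 1) (y : V → ℤˣ) :
    0 ≤ labelWeight q y :=
  Finset.prod_nonneg fun v _ => by
    split_ifs
    · exact h0 v
    · linarith [h1 v]

variable [DecidableEq V]

/-- Group the labelings in pairs which differ at `v` only. -/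
theorem sum_eq_sum_pairs (v : V) (F : (V → ℤˣ) → ℝ) :
    ∑ y, F y = ∑ y, if y v = -1 then F y + F (Function.update y v 1) else 0 := by
  have h : ∑ y : V → ℤˣ, (if y v = 1 then F y else 0) =
      ∑ y, if y v = -1 then F (Function.update y v 1) else 0 := by
    rw [← Finset.sum_filter, ← Finset.sum_filter]
    refine Finset.sum_nbij' (fun y => Function.update y v (-1)) (fun y => Function.update y v 1)
      ?_ ?_ ?_ ?_ ?_
    · simp
    · simp
    · intro y hy
      simp only [Finset.mem_filter, Finset.mem_univ, true_and] at hy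
      simp [← hy]
    · intro y hy
      simp only [Finset.mem_filter, Finset.mem_univ, true_and] at hy
      simp [← hy]
    · intro y hy
      simp only [Finset.mem_filter, Finset.mem_univ, true_and] at hy
      simp [← hy]
  calc ∑ y, F y = ∑ y : V → ℤˣ, ((if y v = -1 then F y else 0) + if y v = 1 then F y else 0) := by
        refine Finset.sum_congr rfl fun y _ => ?_
        rcases Int.units_eq_one_or (y v) with hy | hy <;> simp [hy]
    _ = ∑ y : V → ℤˣ, ((if y v = -1 then F y else 0) +
          if y v = -1 then F (Function.update y v 1) else 0) := by
        rw [Finset.sum_add_distrib, h, ← Finset.sum_add_distrib]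
    _ = _ := Finset.sum_congr rfl fun y _ => by split_ifs <;> simp

theorem sum_labelWeight (q : V → ℝ) : ∑ y, labelWeight q y = 1 := by
  have h := Finset.prod_univ_sum (fun _ : V => (Finset.univ : Finset ℤˣ))
    (fun v s => if s = -1 then q v else 1 - q v)
  rw [Fintype.piFinset_univ] at h
  simp only [labelWeight]
  rw [← h]
  refine Finset.prod_eq_one fun v _ => ?_
  have : (Finset.univ : Finset ℤˣ) = {1, -1} := rfl
  rw [this, Finset.sum_pair (by decide)]
  simp

theorem labelWeight_update (q : V → ℝ) {y : V → ℤˣ} {v : V} (hy : y v = -1) :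
    q v * labelWeight q (Function.update y v 1) = (1 - q v) * labelWeight q y := by
  simp only [labelWeight]
  rw [← Finset.mul_prod_erase _ _ (Finset.mem_univ v),
    ← Finset.mul_prod_erase (a := v) _ (fun u => if y u = -1 then q u else 1 - q u)
      (Finset.mem_univ v)]
  have h : ∏ u ∈ Finset.univ.erase v,
      (if Function.update y v 1 u = -1 then q u else 1 - q u) =
      ∏ u ∈ Finset.univ.erase v, if y u = -1 then q u else 1 - q u :=
    Finset.prod_congr rfl fun u hu => by
      rw [Function.update_of_ne (Finset.ne_of_mem_erase hu)]
  have h1 : ¬ (1 : ℤˣ) = -1 := by decide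
  simp only [h, Function.update_self, hy, if_true, if_neg h1]
  ring

theorem labelWeight_le_update {q : V → ℝ} (h0 : ∀ v, 0 ≤ q v) (h1 : ∀ v, q v ≤ 1 / 2)
    {y : V → ℤˣ} {v : V} (hy : y v = -1) :
    labelWeight q y ≤ labelWeight q (Function.update y v 1) := by
  have hn := labelWeight_nonneg h0 (fun v => (h1 v).trans (by norm_num))
  -- Dividing `labelWeight_update` by `q v` needs `q v ≠ 0`; otherwise `y` itself has weight zero.
  rcases (h0 v).eq_or_lt with hq | hq
  · refine le_trans (le_of_eq ?_) (hn _)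
    exact Finset.prod_eq_zero (Finset.mem_univ v) (by simp [hy, ← hq])
  · have h := labelWeight_update q hy
    have := hn y
    refine le_of_mul_le_mul_left ?_ hq
    rw [h]
    exact mul_le_mul_of_nonneg_right (by linarith [h1 v]) this

/-- The label of `v` is independent of everything that does not depend on it. -/
theorem sum_labelWeight_mul_ite (q : V → ℝ) (v : V) (h : (V → ℤˣ) → ℝ)
    (hh : ∀ y, h (Function.update y v 1) = h y) :
    ∑ y, labelWeight q y * (if y v = -1 then h y else 0) = q v * ∑ y, labelWeight q y * h y := by
  rw [sum_eq_sum_pairs v (fun y => labelWeight q y * h y), Finset.mul_sum]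
  refine Finset.sum_congr rfl fun y _ => ?_
  by_cases hy : y v = -1
  · simp only [if_pos hy, hh]
    linear_combination (-h y) * labelWeight_update q hy
  · simp [hy]

theorem sum_labelWeight_mul_negWeight (q w : V → ℝ) :
    ∑ y, labelWeight q y * negWeight w y = ∑ v, q v * w v := by
  simp only [negWeight, Finset.mul_sum]
  rw [Finset.sum_comm]
  refine Finset.sum_congr rfl fun v _ => ?_
  rw [sum_labelWeight_mul_ite q v (fun _ => w v) (fun _ => rfl), ← Finset.sum_mul,
    sum_labelWeight, one_mul]

/-- The centred indicators `z v` are pairwise uncorrelated, and each has variance `q v (1 - q v) ≤ q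
v`. -/
theorem sum_labelWeight_mul_sq_le {q : V → ℝ} (w : V → ℝ) :
    ∑ y, labelWeight q y * (negWeight w y - ∑ v, q v * w v) ^ 2 ≤ ∑ v, q v * w v ^ 2 := by
  let z : V → (V → ℤˣ) → ℝ := fun v y => (if y v = -1 then 1 else 0) - q v
  have hz : ∀ y, negWeight w y - ∑ v, q v * w v = ∑ v, w v * z v y := fun y => by
    simp only [negWeight, z, ← Finset.sum_sub_distrib]
    exact Finset.sum_congr rfl fun v _ => by split_ifs <;> ring
  have hmean : ∀ v (h : (V → ℤˣ) → ℝ), (∀ y, h (Function.update y v 1) = h y) →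
      ∑ y, labelWeight q y * (z v y * h y) = 0 := by
    intro v h hh
    have := sum_labelWeight_mul_ite q v h hh
    rw [Finset.mul_sum, ← sub_eq_zero, ← Finset.sum_sub_distrib] at this
    rw [← this]
    refine Finset.sum_congr rfl fun y _ => ?_
    simp only [z]
    split_ifs <;> ring
  have hsq : ∀ v, ∑ y, labelWeight q y * (z v y * z v y) ≤ q v := by
    intro v
    have h1 := sum_labelWeight_mul_ite q v (fun _ => 1) (fun _ => rfl)
    have h2 := hmean v (fun _ => 1) (fun _ => rfl)
    have h3 := sum_labelWeight q
    have h4 : ∑ y, labelWeight q y * (z v y * z v y) =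
        ∑ y, labelWeight q y * (if y v = -1 then 1 else 0) -
          2 * q v * ∑ y, labelWeight q y * (z v y * 1) - q v ^ 2 * ∑ y, labelWeight q y := by
      rw [Finset.mul_sum, Finset.mul_sum, ← Finset.sum_sub_distrib, ← Finset.sum_sub_distrib]
      refine Finset.sum_congr rfl fun y _ => ?_
      simp only [z]
      split_ifs <;> ring
    simp only [mul_one] at h1 h2 h4
    rw [h4, h1, h2, h3]
    nlinarith [sq_nonneg (q v)]
  calc ∑ y, labelWeight q y * (negWeight w y - ∑ v, q v * w v) ^ 2
      = ∑ v, ∑ u, w v * w u * ∑ y, labelWeight q y * (z v y * z u y) := by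
        simp only [hz, sq, Fintype.sum_mul_sum]
        simp only [Finset.mul_sum]
        rw [Finset.sum_comm]
        refine Finset.sum_congr rfl fun v _ => ?_
        rw [Finset.sum_comm]
        exact Finset.sum_congr rfl fun u _ => Finset.sum_congr rfl fun y _ => by ring
    _ = ∑ v, w v * w v * ∑ y, labelWeight q y * (z v y * z v y) := by
        refine Finset.sum_congr rfl fun v _ => ?_
        refine Finset.sum_eq_single v (fun u _ huv => ?_) (by simp)
        rw [hmean v (z u) (fun y => by simp only [z, Function.update_of_ne huv]), mul_zero]
    _ ≤ ∑ v, q v * w v ^ 2 := by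
        refine Finset.sum_le_sum fun v _ => ?_
        have := mul_le_mul_of_nonneg_left (hsq v) (mul_self_nonneg (w v))
        linarith [this]

/-- A learner errs on an unqueried node at least as often as that node has the less likely
label `-1`. -/
theorem sum_mul_card_le_sum_mul_mistakes (A : Learner V) {m : (V → ℤˣ) → ℝ} (hm : ∀ y, 0 ≤ m y)
    (hmono : ∀ y v, y v = -1 → m y ≤ m (Function.update y v 1)) :
    ∑ y, m y * negWeight (fun v => if v ∈ A.querySet y then 0 else 1) y ≤
      ∑ y, m y * A.mistakes y := by
  have hmis : ∀ y, (A.mistakes y : ℝ) =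
      ∑ v, if v ∉ A.querySet y ∧ A.prediction y v ≠ y v then 1 else 0 := fun y => by
    simp [Learner.mistakes]
  simp only [hmis, negWeight, Finset.mul_sum]
  rw [Finset.sum_comm, Finset.sum_comm (s := Finset.univ (α := V → ℤˣ))]
  refine Finset.sum_le_sum fun v _ => ?_
  -- An unqueried `v` gets the same prediction on both labelings of a pair, so exactly one of them
  -- counts a mistake; by `hmono` its mass is at least that of the one with `y v = -1`.
  rw [sum_eq_sum_pairs v
    (fun y => m y * if v ∉ A.querySet y ∧ A.prediction y v ≠ y v then (1 : ℝ) else 0)]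
  refine Finset.sum_le_sum fun y _ => ?_
  by_cases hy : y v = -1
  · by_cases hv : v ∈ A.querySet y
    · simp [hy, hv, A.mem_querySet_update_iff]
    · have h1 := hmono y v hy
      have h2 := hm y
      have h3 := (A.run_update_of_notMem y v 1 hv).2
      have h4 : (-1 : ℤˣ) ≠ 1 := by decide
      rcases Int.units_eq_one_or (A.prediction y v) with hp | hp <;>
        simp [hy, hv, A.mem_querySet_update_iff, h3, hp, h4, h4.symm, h1]
  · simp [hy]

/-- Whether `v` is queried does not depend on the label of `v`, so the two are independent. -/
theorem sum_labelWeight_mul_unqueried (A : Learner V) (q : V → ℝ) :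
    ∑ y, labelWeight q y * negWeight (fun v => if v ∈ A.querySet y then 0 else 1) y =
      ∑ y, labelWeight q y * ∑ v, q v * if v ∈ A.querySet y then 0 else 1 := by
  simp only [negWeight, Finset.mul_sum]
  rw [Finset.sum_comm, Finset.sum_comm (s := Finset.univ (α := V → ℤˣ))]
  refine Finset.sum_congr rfl fun v _ => ?_
  rw [sum_labelWeight_mul_ite q v (fun y => if v ∈ A.querySet y then 0 else 1)
    (fun y => by simp only [A.mem_querySet_update_iff]), Finset.mul_sum]
  exact Finset.sum_congr rfl fun y _ => by ring

/-- If `q ≤ c` and the learner makes at most `b` queries, the expected number of unqueried nodes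
with the label `-1` is at least `∑ q - c b`. -/
theorem le_sum_labelWeight_mul_unqueried (A : Learner V) {q : V → ℝ} {c b : ℝ}
    (h0 : ∀ v, 0 ≤ q v) (h1 : ∀ v, q v ≤ 1) (hc0 : 0 ≤ c) (hc : ∀ v, q v ≤ c)
    (hA : ∀ y, ((A.querySet y).card : ℝ) ≤ b) :
    ∑ v, q v - c * b ≤
      ∑ y, labelWeight q y * negWeight (fun v => if v ∈ A.querySet y then 0 else 1) y := by
  rw [sum_labelWeight_mul_unqueried]
  have key : ∀ y, ∑ v, q v - c * b ≤ ∑ v, q v * if v ∈ A.querySet y then 0 else 1 := by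
    intro y
    have h2 : ∑ v, q v * (if v ∈ A.querySet y then 0 else 1) =
        ∑ v, q v - ∑ v ∈ A.querySet y, q v := by
      rw [← Finset.sum_filter_add_sum_filter_not Finset.univ (· ∈ A.querySet y) q]
      simp [Finset.sum_ite]
    have h3 : ∑ v ∈ A.querySet y, q v ≤ (A.querySet y).card * c := by
      have := Finset.sum_le_card_nsmul (A.querySet y) q c (fun v _ => hc v)
      rwa [nsmul_eq_mul] at this
    have h4 := mul_le_mul_of_nonneg_right (hA y) hc0
    linarith
  calc ∑ v, q v - c * b = ∑ y, labelWeight q y * (∑ v, q v - c * b) := by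
        rw [← Finset.sum_mul, sum_labelWeight, one_mul]
    _ ≤ _ := Finset.sum_le_sum fun y _ =>
        mul_le_mul_of_nonneg_left (key y) (labelWeight_nonneg h0 h1 y)

end ProductWeight

/-! ### Truncation and tail bounds -/

section Law

variable {V : Type u} [Fintype V] [DecidableEq V]

/-- The law of independent labels, that of `v` being `-1` with probability `q v`. -/
noncomputable def labelLaw (q : V → ℝ) (h0 : ∀ v, 0 ≤ q v) (h1 : ∀ v, q v ≤ 1) : PMF (V → ℤˣ) :=
  PMF.ofFintype (fun y => ENNReal.ofReal (labelWeight q y)) (by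
    rw [← ENNReal.ofReal_sum_of_nonneg fun y _ => labelWeight_nonneg h0 h1 y, sum_labelWeight,
      ENNReal.ofReal_one])

theorem labelLaw_apply (q : V → ℝ) (h0 : ∀ v, 0 ≤ q v) (h1 : ∀ v, q v ≤ 1) (y : V → ℤˣ) :
    labelLaw q h0 h1 y = ENNReal.ofReal (labelWeight q y) := rfl

/-- A lower bound on the mistakes of all deterministic learners carries over to randomized ones. -/
theorem ofReal_le_expectedMistakes {μ : PMF (V → ℤˣ)} {m : (V → ℤˣ) → ℝ} (hm : ∀ y, 0 ≤ m y)
    (hμ : ∀ y, ENNReal.ofReal (m y) ≤ μ y) {ρ : PMF (Learner V)} {c : ℝ}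
    (h : ∀ A ∈ ρ.support, c ≤ ∑ y, m y * A.mistakes y) :
    ENNReal.ofReal c ≤ expectedMistakes μ ρ := by
  have hA : ∀ A, ρ A * ENNReal.ofReal c ≤ ∑' y, μ y * ρ A * (A.mistakes y : ℝ≥0∞) := by
    intro A
    by_cases hs : A ∈ ρ.support
    · calc ρ A * ENNReal.ofReal c
          ≤ ρ A * ENNReal.ofReal (∑ y, m y * A.mistakes y) := by
            gcongr
            exact h A hs
        _ = ∑ y, ρ A * (ENNReal.ofReal (m y) * (A.mistakes y : ℝ≥0∞)) := by
            rw [ENNReal.ofReal_sum_of_nonneg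
              (fun y _ => mul_nonneg (hm y) (Nat.cast_nonneg _)), Finset.mul_sum]
            refine Finset.sum_congr rfl fun y _ => ?_
            rw [ENNReal.ofReal_mul (hm y), ENNReal.ofReal_natCast]
        _ ≤ ∑ y, μ y * ρ A * (A.mistakes y : ℝ≥0∞) := by
            refine Finset.sum_le_sum fun y _ => ?_
            rw [mul_comm (μ y), mul_assoc]
            gcongr
            exact hμ y
        _ = _ := (tsum_fintype _).symm
    · have : ρ A = 0 := by simpa [PMF.mem_support_iff] using hs
      simp [this]
  calc ENNReal.ofReal c = ∑' A, ρ A * ENNReal.ofReal c := by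
        rw [ENNReal.tsum_mul_right, ρ.tsum_coe, one_mul]
    _ ≤ ∑' A, ∑' y, μ y * ρ A * (A.mistakes y : ℝ≥0∞) := ENNReal.tsum_le_tsum hA
    _ = expectedMistakes μ ρ := ENNReal.tsum_comm

theorem expectedCutsize_le_of_forall_mem_support (G : SimpleGraph V) [DecidableRel G.Adj]
    {μ : PMF (V → ℤˣ)} {K : ℝ} (h : ∀ y ∈ μ.support, resistanceCutsize G y ≤ K) :
    expectedCutsize G μ ≤ K := by
  have h1 : ∑ y, (μ y).toReal = 1 := by
    have h2 := μ.tsum_coe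
    rw [tsum_fintype] at h2
    rw [← ENNReal.toReal_sum fun y _ => μ.apply_ne_top y, h2, ENNReal.toReal_one]
  calc expectedCutsize G μ ≤ ∑ y, (μ y).toReal * K := by
        refine Finset.sum_le_sum fun y _ => ?_
        by_cases hy : y ∈ μ.support
        · exact mul_le_mul_of_nonneg_left (h y hy) ENNReal.toReal_nonneg
        · have : μ y = 0 := by simpa [PMF.mem_support_iff] using hy
          simp [this]
    _ = K := by rw [← Finset.sum_mul, h1, one_mul]

theorem negWeight_update_le {w : V → ℝ} (hw : ∀ v, 0 ≤ w v) (y : V → ℤˣ) (v : V) :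
    negWeight w (Function.update y v 1) ≤ negWeight w y := by
  refine Finset.sum_le_sum fun u _ => ?_
  have h1 : (1 : ℤˣ) ≠ -1 := by decide
  by_cases huv : u = v
  · subst huv
    have := hw u
    simp only [Function.update_self, if_neg h1]
    split_ifs <;> linarith
  · rw [Function.update_of_ne huv]

/-- Independent labels conditioned on a bounded weight of the negative nodes still force
mistakes: the loss is at most the mean of the number of negative nodes on the excluded event. -/
theorem le_sum_truncated_mul_mistakes (A : Learner V) {q w : V → ℝ} {c b T : ℝ}
    (h0 : ∀ v, 0 ≤ q v) (h1 : ∀ v, q v ≤ 1 / 2) (hc0 : 0 ≤ c) (hc : ∀ v, q v ≤ c)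
    (hw : ∀ v, 0 ≤ w v) (hA : ∀ y, ((A.querySet y).card : ℝ) ≤ b) :
    ∑ v, q v - c * b -
        ∑ y, labelWeight q y * (if T < negWeight w y then negWeight (fun _ => 1) y else 0) ≤
      ∑ y, (if negWeight w y ≤ T then labelWeight q y else 0) * A.mistakes y := by
  have h1' : ∀ v, q v ≤ 1 := fun v => (h1 v).trans (by norm_num)
  have hP := labelWeight_nonneg h0 h1'
  have hmis := sum_mul_card_le_sum_mul_mistakes A
    (m := fun y => if negWeight w y ≤ T then labelWeight q y else 0)
    (fun y => by
      split_ifs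
      · exact hP y
      · exact le_rfl)
    -- Turning `-1` into `1` cannot leave the event `negWeight w y ≤ T`, so the truncated mass is
    -- still monotone.
    (fun y v hy => by
      by_cases h : negWeight w y ≤ T
      · rw [if_pos h, if_pos ((negWeight_update_le hw y v).trans h)]
        exact labelWeight_le_update h0 h1 hy
      · rw [if_neg h]
        split_ifs
        · exact hP _
        · exact le_rfl)
  refine le_trans ?_ hmis
  have hq := le_sum_labelWeight_mul_unqueried A h0 h1' hc0 hc hA
  rw [sub_le_iff_le_add]
  refine hq.trans ?_
  rw [← Finset.sum_add_distrib]
  refine Finset.sum_le_sum fun y _ => ?_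
  by_cases h : negWeight w y ≤ T
  · simp [h, not_lt.mpr h]
  · rw [if_neg h, if_pos (not_le.mp h), zero_mul, zero_add]
    refine mul_le_mul_of_nonneg_left (negWeight_mono (fun v => ?_) y) (hP y)
    split_ifs <;> norm_num

/-- Split the number of negative nodes as `n + s` plus an excess. On the tail the weight is more
than `t` above its mean, so Chebyshev handles `n + s`; the excess is controlled by `x - s ≤ x ^ 2 /
s`. -/
theorem sum_labelWeight_mul_tail_le {q w : V → ℝ} {T t s : ℝ} (h0 : ∀ v, 0 ≤ q v)
    (h1 : ∀ v, q v ≤ 1) (ht : 0 < t) (hs : 0 < s) (hT : ∑ v, q v * w v + t ≤ T) :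
    ∑ y, labelWeight q y * (if T < negWeight w y then negWeight (fun _ => 1) y else 0) ≤
      (∑ v, q v + s) / t ^ 2 * ∑ v, q v * w v ^ 2 + (∑ v, q v) / s := by
  have hP := labelWeight_nonneg h0 h1
  have hX := sum_labelWeight_mul_sq_le (q := q) w
  have hN := sum_labelWeight_mul_sq_le (q := q) (fun _ => 1)
  simp only [mul_one, one_pow] at hN
  set a := ∑ v, q v * w v
  set n := ∑ v, q v
  have hn : 0 ≤ n := Finset.sum_nonneg fun v _ => h0 v
  have key : ∀ y : V → ℤˣ, (if T < negWeight w y then negWeight (fun _ => 1) y else 0) ≤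
      (n + s) / t ^ 2 * (negWeight w y - a) ^ 2 + (negWeight (fun _ => 1) y - n) ^ 2 / s := by
    intro y
    split_ifs with hy
    · have e1 : n + s ≤ (n + s) / t ^ 2 * (negWeight w y - a) ^ 2 := by
        rw [div_mul_eq_mul_div, le_div_iff₀ (by positivity)]
        refine mul_le_mul_of_nonneg_left ?_ (by positivity)
        exact pow_le_pow_left₀ ht.le (by linarith) 2
      have e2 : negWeight (fun _ => 1) y - n - s ≤ (negWeight (fun _ => 1) y - n) ^ 2 / s := by
        rw [le_div_iff₀ hs]
        nlinarith [sq_nonneg (negWeight (fun _ => 1) y - n - s), sq_nonneg s,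
          sq_nonneg (negWeight (fun _ => 1) y - n)]
      linarith
    · positivity
  calc _ ≤ ∑ y, labelWeight q y * ((n + s) / t ^ 2 * (negWeight w y - a) ^ 2 +
          (negWeight (fun _ => 1) y - n) ^ 2 / s) :=
        Finset.sum_le_sum fun y _ => mul_le_mul_of_nonneg_left (key y) (hP y)
    _ = (n + s) / t ^ 2 * ∑ y, labelWeight q y * (negWeight w y - a) ^ 2 +
          (∑ y, labelWeight q y * (negWeight (fun _ => 1) y - n) ^ 2) / s := by
        rw [Finset.mul_sum, Finset.sum_div, ← Finset.sum_add_distrib]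
        exact Finset.sum_congr rfl fun y _ => by ring
    _ ≤ _ := by gcongr

/-! ### The choice of probabilities and the numerical bounds -/

/-- Negative labels with probability `c`, at the nodes of resistance degree at most `16` only. -/
noncomputable def lowDegreeProb (G : SimpleGraph V) [DecidableRel G.Adj] (c : ℝ) (v : V) : ℝ :=
  if resistanceDegree G v ≤ 16 then c else 0

variable (G : SimpleGraph V) [DecidableRel G.Adj] {c : ℝ}

theorem lowDegreeProb_nonneg (hc : 0 ≤ c) (v : V) : 0 ≤ lowDegreeProb G c v := by
  unfold lowDegreeProb
  split_ifs
  · exact hc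
  · exact le_rfl

theorem lowDegreeProb_le (hc : 0 ≤ c) (v : V) : lowDegreeProb G c v ≤ c := by
  unfold lowDegreeProb
  split_ifs
  · exact le_rfl
  · exact hc

theorem sum_lowDegreeProb_le (hc : 0 ≤ c) : ∑ v, lowDegreeProb G c v ≤ c * Fintype.card V := by
  refine (Finset.sum_le_card_nsmul _ _ c fun v _ => lowDegreeProb_le G hc v).trans (le_of_eq ?_)
  rw [nsmul_eq_mul, Finset.card_univ, mul_comm]

/-- By Markov's inequality, at most one node in eight has resistance degree above `16`. -/
theorem le_sum_lowDegreeProb (hc : 0 ≤ c) :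
    7 / 8 * (c * Fintype.card V) ≤ ∑ v, lowDegreeProb G c v := by
  have h : ∀ v, c - c * (resistanceDegree G v / 16) ≤ lowDegreeProb G c v := by
    intro v
    have hd := resistanceDegree_nonneg G v
    unfold lowDegreeProb
    split_ifs with hv
    · have : 0 ≤ c * (resistanceDegree G v / 16) := by positivity
      linarith
    · nlinarith
  have h2 := Finset.sum_le_sum fun v (_ : v ∈ Finset.univ) => h v
  have h3 := mul_le_mul_of_nonneg_left (sum_resistanceDegree_le G) hc
  simp only [Finset.sum_sub_distrib, ← Finset.mul_sum, ← Finset.sum_div, Finset.sum_const,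
    Finset.card_univ, nsmul_eq_mul] at h2
  linarith

theorem sum_lowDegreeProb_mul_resistanceDegree_le (hc : 0 ≤ c) :
    ∑ v, lowDegreeProb G c v * resistanceDegree G v ≤ 2 * (c * Fintype.card V) := by
  have h3 := mul_le_mul_of_nonneg_left (sum_resistanceDegree_le G) hc
  rw [Finset.mul_sum] at h3
  refine (Finset.sum_le_sum fun v _ => mul_le_mul_of_nonneg_right (lowDegreeProb_le G hc v)
    (resistanceDegree_nonneg G v)).trans ?_
  linarith

/-- The cutoff at `16` reduces the second moment to the first, keeping it linear in `c|V|`. -/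
theorem sum_lowDegreeProb_mul_resistanceDegree_sq_le (hc : 0 ≤ c) :
    ∑ v, lowDegreeProb G c v * resistanceDegree G v ^ 2 ≤ 32 * (c * Fintype.card V) := by
  have h : ∀ v, lowDegreeProb G c v * resistanceDegree G v ^ 2 ≤
      16 * (lowDegreeProb G c v * resistanceDegree G v) := by
    intro v
    have hd := resistanceDegree_nonneg G v
    unfold lowDegreeProb
    split_ifs with hv
    · nlinarith [mul_nonneg hc hd]
    · simp
  have h2 := Finset.sum_le_sum fun v (_ : v ∈ Finset.univ) => h v
  rw [← Finset.mul_sum] at h2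
  linarith [sum_lowDegreeProb_mul_resistanceDegree_le G hc]

variable {K : ℝ}

theorem le_sum_labelWeight_mul_mistakes (hc : 0 ≤ c) (hc' : c ≤ 1 / 2)
    (hcK : c * Fintype.card V = 9 * K / 20) (hK : 0 ≤ K) (A : Learner V)
    (hA : ∀ y, ((A.querySet y).card : ℝ) ≤ (Fintype.card V : ℝ) / 4) :
    K / 4 ≤ ∑ y, labelWeight (lowDegreeProb G c) y * A.mistakes y := by
  -- With zero weights the truncation is vacuous.
  have h := le_sum_truncated_mul_mistakes A (q := lowDegreeProb G c) (w := fun _ => 0) (T := 0)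
    (lowDegreeProb_nonneg G hc) (fun v => (lowDegreeProb_le G hc v).trans hc') hc
    (lowDegreeProb_le G hc) (fun _ => le_rfl) hA
  simp only [negWeight, ite_self, Finset.sum_const_zero, lt_irrefl, if_false, le_refl, if_true,
    mul_zero, sub_zero] at h
  have := le_sum_lowDegreeProb G hc
  -- `(7/8 - 1/4) * 9/20 = 9/32`, which exceeds `1/4`.
  linarith

theorem le_sum_truncated_labelWeight_mul_mistakes (hc : 0 ≤ c) (hc' : c ≤ 1 / 2)
    (hcK : c * Fintype.card V = 9 * K / 20) (hK : 100000 ≤ K) (A : Learner V)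
    (hA : ∀ y, ((A.querySet y).card : ℝ) ≤ (Fintype.card V : ℝ) / 4) :
    K / 4 ≤ ∑ y, (if negWeight (resistanceDegree G) y ≤ K then
      labelWeight (lowDegreeProb G c) y else 0) * A.mistakes y := by
  have h0 := lowDegreeProb_nonneg G hc
  have h1 : ∀ v, lowDegreeProb G c v ≤ 1 / 2 := fun v => (lowDegreeProb_le G hc v).trans hc'
  have hK0 : 0 < K := by linarith
  have h := le_sum_truncated_mul_mistakes A (q := lowDegreeProb G c) (w := resistanceDegree G)
    (T := K) h0 h1 hc (lowDegreeProb_le G hc) (resistanceDegree_nonneg G) hA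
  -- The mean weight is at most `9K/10`, leaving `t = K / 10` below the threshold `K`.
  have ht := sum_labelWeight_mul_tail_le (q := lowDegreeProb G c) (w := resistanceDegree G)
    (T := K) (t := K / 10) (s := K) h0 (fun v => (h1 v).trans (by norm_num)) (by linarith) hK0
    (by linarith [sum_lowDegreeProb_mul_resistanceDegree_le G hc])
  have e1 := sum_lowDegreeProb_mul_resistanceDegree_sq_le G hc
  have e2 := sum_lowDegreeProb_le G hc
  have e3 := le_sum_lowDegreeProb G hc
  have hb : (∑ v, lowDegreeProb G c v + K) / (K / 10) ^ 2 *
      ∑ v, lowDegreeProb G c v * resistanceDegree G v ^ 2 + (∑ v, lowDegreeProb G c v) / K ≤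
      2089 := by
    rw [hcK] at e1 e2
    calc _ ≤ (9 * K / 20 + K) / (K / 10) ^ 2 * (32 * (9 * K / 20)) + (9 * K / 20) / K := by
          have : 0 ≤ ∑ v, lowDegreeProb G c v * resistanceDegree G v ^ 2 :=
            Finset.sum_nonneg fun v _ => mul_nonneg (h0 v) (sq_nonneg _)
          gcongr
      _ ≤ 2089 := by
          have : (9 * K / 20 + K) / (K / 10) ^ 2 * (32 * (9 * K / 20)) + (9 * K / 20) / K =
              2088 + 9 / 20 := by
            field_simp
            norm_num
          rw [this]
          norm_num
  -- The slack `9K/32 - K/4 = K/32` exceeds the loss `2089` once `K ≥ 100000`.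
  linarith

end Law

end ActiveGraph

theorem mainTheorem7 :
    ∃ K₀ : ℝ, ∀ (V : Type u) [Fintype V] [DecidableEq V] (G : SimpleGraph V) [DecidableRel G.Adj]
      (K : ℝ), 0 ≤ K → K ≤ (Fintype.card V : ℝ) / 2 →
      ∃ μ : PMF (V → ℤˣ),
        (∀ ρ : PMF (ActiveGraph.Learner V), ActiveGraph.QueriesAtMostQuarter ρ →
          ENNReal.ofReal (K / 4) ≤ ActiveGraph.expectedMistakes μ ρ) ∧
        ActiveGraph.expectedCutsize G μ ≤ K ∧
        (K₀ ≤ K → ∀ y ∈ μ.support, ActiveGraph.resistanceCutsize G y ≤ K) := by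
  refine ⟨100000, fun V _ _ G _ K hK0 hKV => ?_⟩
  obtain ⟨c, hc, hc', hcK⟩ :
      ∃ c : ℝ, 0 ≤ c ∧ c ≤ 1 / 2 ∧ c * Fintype.card V = 9 * K / 20 := by
    -- An empty `V` forces `K = 0`.
    rcases (Nat.cast_nonneg (α := ℝ) (Fintype.card V)).eq_or_lt with hn | hn
    · exact ⟨0, le_rfl, by norm_num, by linarith⟩
    · refine ⟨9 * K / 20 / Fintype.card V, by positivity, ?_, div_mul_cancel₀ _ hn.ne'⟩
      rw [div_le_iff₀ hn]
      linarith
  set q := ActiveGraph.lowDegreeProb G c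
  have h0 : ∀ v, 0 ≤ q v := ActiveGraph.lowDegreeProb_nonneg G hc
  have h1 : ∀ v, q v ≤ 1 := fun v =>
    (ActiveGraph.lowDegreeProb_le G hc v).trans (hc'.trans (by norm_num))
  have hP := ActiveGraph.labelWeight_nonneg h0 h1
  by_cases hK : 100000 ≤ K
  · let f : (V → ℤˣ) → V → ℤˣ := fun y =>
      if ActiveGraph.negWeight (ActiveGraph.resistanceDegree G) y ≤ K then y else 1
    have hsupp : ∀ y ∈ ((ActiveGraph.labelLaw q h0 h1).map f).support,
        ActiveGraph.resistanceCutsize G y ≤ K := by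
      intro y hy
      rw [PMF.support_map] at hy
      obtain ⟨z, -, rfl⟩ := hy
      simp only [f]
      split_ifs with hz
      · exact (ActiveGraph.resistanceCutsize_le_negWeight G z).trans hz
      · simpa [ActiveGraph.resistanceCutsize] using hK0
    refine ⟨(ActiveGraph.labelLaw q h0 h1).map f, fun ρ hρ => ?_,
      ActiveGraph.expectedCutsize_le_of_forall_mem_support G hsupp, fun _ => hsupp⟩
    refine ActiveGraph.ofReal_le_expectedMistakes
      (m := fun y => if ActiveGraph.negWeight (ActiveGraph.resistanceDegree G) y ≤ K then
        ActiveGraph.labelWeight q y else 0) (fun y => ?_) (fun y => ?_)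
      (fun A hA => ActiveGraph.le_sum_truncated_labelWeight_mul_mistakes G hc hc' hcK hK A
        (hρ A hA))
    · split_ifs
      · exact hP y
      · exact le_rfl
    · split_ifs with hy
      · rw [PMF.map_apply]
        refine le_trans ?_ (ENNReal.le_tsum y)
        simp [f, hy, ActiveGraph.labelLaw_apply]
      · simp
  · refine ⟨ActiveGraph.labelLaw q h0 h1, fun ρ hρ => ?_, ?_, fun h => absurd h hK⟩
    · exact ActiveGraph.ofReal_le_expectedMistakes hP (fun y => le_rfl)
        (fun A hA => ActiveGraph.le_sum_labelWeight_mul_mistakes G hc hc' hcK hK0 A (hρ A hA))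
    · calc ActiveGraph.expectedCutsize G (ActiveGraph.labelLaw q h0 h1)
          ≤ ∑ y, ActiveGraph.labelWeight q y *
              ActiveGraph.negWeight (ActiveGraph.resistanceDegree G) y := by
            refine Finset.sum_le_sum fun y _ => ?_
            rw [ActiveGraph.labelLaw_apply, ENNReal.toReal_ofReal (hP y)]
            exact mul_le_mul_of_nonneg_left (ActiveGraph.resistanceCutsize_le_negWeight G y) (hP y)
        _ ≤ K := by
            rw [ActiveGraph.sum_labelWeight_mul_negWeight]
            linarith [ActiveGraph.sum_lowDegreeProb_mul_resistanceDegree_le G hc]
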